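/- Let $n$ be the number of agents and $t_0\in\mathbb R$. A Carathéodory trajectory of the closed continuous-time Hegselmann–Krause dynamics is a function $x:[t_0,\infty)\to\mathbb R^n$ such that, for every agent $i$ and every $t\ge t_0$, the integrand below is integrable on $[t_0,t]$ and $$x_i(t)=x_i(t_0)+\int_{t_0}^t\ \sum_{j:\,|x_i(\tau)-x_j(\tau)|<1}\bigl(x_j(\tau)-x_i(\tau)\bigr)\,d\tau .$$ For $x\in\mathbb R^n$, join two distinct agents $i,j$ by an edge when $|x_i-x_j|<1$, call the connected components of this graph clusters, let $\bar x_i$ be the average of the opinions in the cluster of agent $i$, and put $$U(x)=\frac1n\sum_{i=1}^n (x_i-\bar x_i)^2 .$$ Proposition. (a) For Lebesgue-almost every initial condition $x_0\in\mathbb R^n$, the function $t\mapsto U(x(t))$ is non-increasing on $[t_0,\infty)$ along every Carathéodory trajectory $x$ with $x(t_0)=x_0$. (b) Along every Carathéodory trajectory $x$, from any initial condition, $\lim_{t\to\infty}U(x(t))=0$. -/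

import Mathlib

open MeasureTheory

namespace HK

noncomputable section

open scoped Classical in
/-- The Hegselmann-Krause vector field: agent `i` is attracted by all agents at distance
strictly less than `1`. -/
def field {n : ℕ} (x : Fin n → ℝ) (i : Fin n) : ℝ :=
  ∑ j with |x i - x j| < 1, (x j - x i)

/-- `x` is a Carathéodory solution on `[t₀, ∞)`: the right-hand side is integrable along `x`
on every `[t₀, t]`, and `x` satisfies the integral equation. -/
def IsCaratheodorySolution {n : ℕ} (t₀ : ℝ) (x : ℝ → Fin n → ℝ) : Prop :=
  ∀ i : Fin n, ∀ t : ℝ, t₀ ≤ t →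
    IntervalIntegrable (fun τ => field (x τ) i) volume t₀ t ∧
      x t i = x t₀ i + ∫ τ in t₀..t, field (x τ) i

/-- The interaction graph of a configuration. -/
def interactionGraph {n : ℕ} (x : Fin n → ℝ) : SimpleGraph (Fin n) where
  Adj i j := i ≠ j ∧ |x i - x j| < 1
  symm := ⟨fun i j h => ⟨h.1.symm, by rw [abs_sub_comm]; exact h.2⟩⟩
  loopless := ⟨fun _ h => h.1 rfl⟩

open scoped Classical in
/-- The cluster of agent `i`: its connected component in the interaction graph. -/
def cluster {n : ℕ} (x : Fin n → ℝ) (i : Fin n) : Finset (Fin n) :=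
  {j | (interactionGraph x).Reachable i j}

/-- The average opinion in the cluster of agent `i` (the cluster contains `i`). -/
def clusterMean {n : ℕ} (x : Fin n → ℝ) (i : Fin n) : ℝ :=
  (∑ j ∈ cluster x i, x j) / ((cluster x i).card : ℝ)

/-- The local variance: average squared deviation of the agents from their cluster means. -/
def localVariance {n : ℕ} (x : Fin n → ℝ) : ℝ :=
  (1 / (n : ℝ)) * ∑ i, (x i - clusterMean x i) ^ 2

end

end HK

/-!
The map `u ↦ u - pull u` is monotone, so the distance between two trajectories contracts at most
exponentially. Hence agents that are apart never meet, and the initial condition is a Lipschitz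
function of the time and place of arrival. The initial conditions from which a trajectory ever
reaches a given affine subspace of codimension two therefore have dimension less than `n` and form a
null set. So a generic trajectory meets the thresholds `|x i - x j| = 1` one pair at a time and
never tangentially, and then consecutive agents that do not interact never start to: their gap could
drop below `1` only with negative speed, but then it would have been constantly `1` just before.
Thus clusters only split. As the local variance is the least mean square deviation from a
clusterwise constant configuration, and the deviation from a fixed such configuration decreases, the
local variance is non-increasing.

For the limit, the total opinion of the lowest agents is non-decreasing, so every trajectory
converges, and two distinct limits are at distance at least `1`. The total `overlap` of the agents
with distinct limits tends to `0`. Near the limit its derivative is a sum of products of an integer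
with a number close to that integer, hence is nonnegative, so the overlap eventually vanishes. From
then on only agents with a common limit interact, and the local variance is at most the mean square
distance to the limit.
-/

namespace HK

open Set Filter Topology

/-! ### Absolutely continuous functions and null sets -/

section AbsolutelyContinuous

variable {f f' : ℝ → ℝ} {a b : ℝ}

theorem absolutelyContinuousOnInterval_const (c a b : ℝ) :
    AbsolutelyContinuousOnInterval (fun _ => c) a b :=
  contDiff_const.contDiffOn.absolutelyContinuousOnInterval

theorem absolutelyContinuousOnInterval_sum {ι : Type*} (s : Finset ι) {f : ι → ℝ → ℝ}
    (hf : ∀ i ∈ s, AbsolutelyContinuousOnInterval (f i) a b) :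
    AbsolutelyContinuousOnInterval (fun t => ∑ i ∈ s, f i t) a b := by
  classical
  induction s using Finset.induction_on with
  | empty => simpa using absolutelyContinuousOnInterval_const 0 a b
  | insert i s hi ih =>
    simp only [Finset.sum_insert hi]
    exact (hf i (by simp)).fun_add (ih fun j hj => hf j (by simp [hj]))

theorem absolutelyContinuousOnInterval_sum_sq {ι : Type*} (s : Finset ι) {f : ι → ℝ → ℝ}
    (hf : ∀ i ∈ s, AbsolutelyContinuousOnInterval (f i) a b) :
    AbsolutelyContinuousOnInterval (fun t => ∑ i ∈ s, f i t ^ 2) a b :=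
  absolutelyContinuousOnInterval_sum s fun i hi => by
    simpa only [pow_two] using (hf i hi).fun_mul (hf i hi)

theorem hasDerivAt_sum_sq {ι : Type*} (s : Finset ι) {f : ι → ℝ → ℝ} {f' : ι → ℝ} {t : ℝ}
    (hf : ∀ i ∈ s, HasDerivAt (f i) (f' i) t) :
    HasDerivAt (fun τ => ∑ i ∈ s, f i τ ^ 2) (2 * ∑ i ∈ s, f' i * f i t) t := by
  rw [Finset.mul_sum]
  refine HasDerivAt.fun_sum fun i hi => ?_
  simpa [mul_assoc, mul_comm, mul_left_comm] using (hf i hi).fun_pow 2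

theorem mul_sub_le_image_sub_of_ae_hasDerivAt {C : ℝ} (hab : a ≤ b)
    (hf : AbsolutelyContinuousOnInterval f a b)
    (hf' : ∀ᵐ t, t ∈ Ioo a b → HasDerivAt f (f' t) t) (hC : ∀ t ∈ Ioo a b, C ≤ f' t) :
    C * (b - a) ≤ f b - f a := by
  have hmono : ∫ _ in a..b, C ≤ ∫ t in a..b, deriv f t := by
    refine intervalIntegral.integral_mono_ae_restrict hab intervalIntegrable_const
      hf.intervalIntegrable_deriv ?_
    rw [← restrict_Ioo_eq_restrict_Icc]
    refine (ae_restrict_iff' measurableSet_Ioo).2 ?_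
    filter_upwards [hf'] with t ht hmem
    exact (hC t hmem).trans_eq (ht hmem).deriv.symm
  simpa [hf.integral_deriv_eq_sub, mul_comm] using hmono

theorem le_of_ae_hasDerivAt_nonneg (hab : a ≤ b) (hf : AbsolutelyContinuousOnInterval f a b)
    (hf' : ∀ᵐ t, t ∈ Ioo a b → HasDerivAt f (f' t) t) (hC : ∀ t ∈ Ioo a b, 0 ≤ f' t) :
    f a ≤ f b := by
  simpa using mul_sub_le_image_sub_of_ae_hasDerivAt hab hf hf' hC

theorem le_exp_mul_of_ae_hasDerivAt {K : ℝ} (hab : a ≤ b)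
    (hf : AbsolutelyContinuousOnInterval f a b)
    (hf' : ∀ᵐ t, t ∈ Ioo a b → HasDerivAt f (f' t) t)
    (hK : ∀ t ∈ Ioo a b, -(K * f t) ≤ f' t) :
    f a ≤ Real.exp (K * (b - a)) * f b := by
  have hexp : ∀ t, HasDerivAt (fun t => Real.exp (K * (t - a))) (Real.exp (K * (t - a)) * K) t :=
    fun t => by simpa using (((hasDerivAt_id t).sub_const a).const_mul K).exp
  have hac : AbsolutelyContinuousOnInterval (fun t => Real.exp (K * (t - a)) * f t) a b :=
    (ContDiff.contDiffOn (by fun_prop)).absolutelyContinuousOnInterval.fun_mul hf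
  simpa using le_of_ae_hasDerivAt_nonneg hab hac (hf'.mono fun t ht h => (hexp t).fun_mul (ht h))
    fun t ht => by
      have := mul_nonneg (Real.exp_pos (K * (t - a))).le (neg_le_iff_add_nonneg.1 (hK t ht))
      linarith

end AbsolutelyContinuous

theorem exists_tendsto_of_monotoneOn_Ici {f : ℝ → ℝ} {T M : ℝ} (hf : MonotoneOn f (Ici T))
    (hM : ∀ t ∈ Ici T, f t ≤ M) : ∃ ℓ, Tendsto f atTop (𝓝 ℓ) := by
  have hmono : Monotone fun t => f (max t T) := fun s t hst =>
    hf (le_max_right s T) (le_max_right t T) (max_le_max_right T hst)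
  have hbdd : BddAbove (range fun t => f (max t T)) :=
    ⟨M, by rintro _ ⟨t, rfl⟩; exact hM _ (le_max_right t T)⟩
  refine ⟨_, (tendsto_atTop_ciSup hmono hbdd).congr' ?_⟩
  filter_upwards [eventually_ge_atTop T] with t ht
  rw [max_eq_left ht]

theorem hasDerivAt_max_zero {g : ℝ → ℝ} {g' t : ℝ} (hg : HasDerivAt g g' t)
    (hmax : DifferentiableAt ℝ (fun τ => max 0 (g τ)) t) :
    HasDerivAt (fun τ => max 0 (g τ)) (if 0 < g t then g' else 0) t := by
  split_ifs with h
  · refine hg.congr_of_eventuallyEq ?_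
    filter_upwards [hg.continuousAt.eventually (lt_mem_nhds h)] with τ hτ
    exact max_eq_right hτ.le
  · have hmin : IsLocalMin (fun τ => max 0 (g τ)) t := Eventually.of_forall fun τ => by
      simp only [max_eq_left (not_lt.1 h), le_max_left]
    simpa only [hmin.deriv_eq_zero] using hmax.hasDerivAt

theorem exists_first_eq {g : ℝ → ℝ} {a b c : ℝ} (hab : a ≤ b) (hg : ContinuousOn g (Icc a b))
    (ha : g a ≤ c) (hb : c ≤ g b) : ∃ s ∈ Icc a b, g s = c ∧ ∀ t ∈ Ico a s, g t < c := by
  have hcomp : IsCompact (Icc a b ∩ g ⁻¹' {c}) :=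
    isCompact_Icc.of_isClosed_subset (hg.preimage_isClosed_of_isClosed isClosed_Icc
      isClosed_singleton) inter_subset_left
  obtain ⟨r, hr, hrc⟩ := intermediate_value_Icc hab hg ⟨ha, hb⟩
  obtain ⟨s, ⟨hs, hsc⟩, hleast⟩ := hcomp.exists_isLeast ⟨r, hr, hrc⟩
  refine ⟨s, hs, hsc, fun t ht => ?_⟩
  by_contra! hct
  obtain ⟨u, hu, huc⟩ := intermediate_value_Icc ht.1
    (hg.mono (Icc_subset_Icc_right (ht.2.le.trans hs.2))) ⟨ha, hct⟩
  exact (hu.2.trans_lt ht.2).not_ge (hleast ⟨⟨hu.1, hu.2.trans (ht.2.le.trans hs.2)⟩, huc⟩)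

theorem exists_last_eq {g : ℝ → ℝ} {a b c : ℝ} (hab : a ≤ b) (hg : ContinuousOn g (Icc a b))
    (ha : c ≤ g a) (hb : g b ≤ c) : ∃ s ∈ Icc a b, g s = c ∧ ∀ t ∈ Ioc s b, g t < c := by
  obtain ⟨s, hs, hsc, hlt⟩ := exists_first_eq (g := fun t => g (-t)) (neg_le_neg hab)
    (hg.comp continuousOn_neg fun t ht => ⟨le_neg.2 ht.2, neg_le.2 ht.1⟩) (by simpa) (by simpa)
  refine ⟨-s, ⟨le_neg.2 hs.2, neg_le.2 hs.1⟩, hsc, fun t ht => ?_⟩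
  simpa using hlt (-t) ⟨neg_le_neg ht.2, neg_lt.1 ht.1⟩

section NullSets

variable {ι E F : Type*} [Fintype ι] [NormedAddCommGroup E] [NormedSpace ℝ E]
  [FiniteDimensional ℝ E]

theorem volume_eq_zero_of_antilipschitz (hdim : Module.finrank ℝ E < Fintype.card ι)
    {S : Set (ι → ℝ)} {f : S → E} {K : NNReal} (hf : AntilipschitzWith K f) : volume S = 0 := by
  have hdimH : dimH S < (Fintype.card ι : NNReal) := calc
    dimH S = dimH ((↑) '' (univ : Set S) : Set (ι → ℝ)) := by simp
    _ = dimH (univ : Set S) := isometry_subtype_coe.dimH_image _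
    _ ≤ dimH (f '' univ) := hf.le_dimH_image _
    _ ≤ dimH (univ : Set E) := dimH_mono (subset_univ _)
    _ = Module.finrank ℝ E := Real.dimH_univ_eq_finrank E
    _ < (Fintype.card ι : NNReal) := by exact_mod_cast hdim
  refine measure_zero_of_dimH_lt ?_ hdimH
  rw [NNReal.coe_natCast, hausdorffMeasure_pi_real]

theorem volume_eq_zero_of_antilipschitz_of_fiber [AddCommGroup F] [Module ℝ F] (L : E →ₗ[ℝ] F)
    (hL : Function.Surjective L)
    (hdim : Module.finrank ℝ E < Fintype.card ι + Module.finrank ℝ F) {c : F}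
    {S : Set (ι → ℝ)} {f : S → E} {K : NNReal} (hf : AntilipschitzWith K f)
    (hc : ∀ p, L (f p) = c) : volume S = 0 := by
  rcases S.eq_empty_or_nonempty with rfl | ⟨p₀, hp₀⟩
  · exact measure_empty
  · have hker : Module.finrank ℝ (LinearMap.ker L) < Fintype.card ι := by
      have := L.finrank_range_add_finrank_ker
      rw [LinearMap.range_eq_top.2 hL, finrank_top] at this
      omega
    let g : S → LinearMap.ker L := fun p => ⟨f p - f ⟨p₀, hp₀⟩, by simp [hc]⟩
    have hg : AntilipschitzWith K g := AntilipschitzWith.of_le_mul_dist fun p q => by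
      simpa [g, Subtype.dist_eq] using hf.le_mul_dist p q
    exact volume_eq_zero_of_antilipschitz hker hg

end NullSets

theorem surjective_prod_of_ne_zero {K V : Type*} [Field K] [AddCommGroup V] [Module K V]
    (f g : V →ₗ[K] K) {u v : V} (hfu : f u ≠ 0) (hfv : f v = 0) (hgv : g v ≠ 0) :
    Function.Surjective (f.prod g) := by
  rintro ⟨p, q⟩
  refine ⟨(p / f u) • u + ((q - p / f u * g u) / g v) • v, Prod.ext ?_ ?_⟩
  · simp [hfu, hfv]
  · simp [hgv]

section Pi

variable {ι : Type*} [Fintype ι]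

theorem dist_le_sqrt_sum_sq (u v : ι → ℝ) : dist u v ≤ √(∑ i, (u i - v i) ^ 2) :=
  (dist_pi_le_iff (Real.sqrt_nonneg _)).2 fun i => Real.abs_le_sqrt <|
    Finset.single_le_sum (f := fun i => (u i - v i) ^ 2) (fun _ _ => sq_nonneg _)
      (Finset.mem_univ i)

theorem sum_sq_le_card_mul_dist_sq (u v : ι → ℝ) :
    ∑ i, (u i - v i) ^ 2 ≤ Fintype.card ι * dist u v ^ 2 := by
  refine (Finset.sum_le_card_nsmul _ _ (dist u v ^ 2) fun i _ => ?_).trans_eq (by simp)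
  rw [← sq_abs, ← Real.dist_eq]
  exact pow_le_pow_left₀ dist_nonneg (dist_le_pi_dist u v i) 2

end Pi

/-! ### Configurations -/

open scoped Classical in
/-- The attraction exerted on an agent by another one at signed distance `u`. Being odd and cut off
at distance `1`, it turns the sum over neighbors in `field` into a sum over all agents. -/
noncomputable def pull (u : ℝ) : ℝ := if |u| < 1 then u else 0

theorem pull_of_abs_lt {u : ℝ} (h : |u| < 1) : pull u = u := if_pos h

theorem pull_of_le_abs {u : ℝ} (h : 1 ≤ |u|) : pull u = 0 := if_neg h.not_gt

theorem pull_neg (u : ℝ) : pull (-u) = -pull u := by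
  unfold pull
  rw [abs_neg]
  split_ifs <;> simp

theorem abs_pull_le (u : ℝ) : |pull u| ≤ 1 := by
  unfold pull
  split_ifs with h
  · exact h.le
  · simp

theorem pull_nonneg {u : ℝ} (h : 0 ≤ u) : 0 ≤ pull u := by
  unfold pull
  split_ifs <;> simp [h]

theorem monotone_sub_pull : Monotone fun u => u - pull u := by
  intro a b hab
  simp only [pull]
  split_ifs with ha hb hb
  · simp
  · rcases le_abs'.1 (not_lt.1 hb) with h | h <;> linarith [neg_lt_of_abs_lt ha]
  · rcases le_abs'.1 (not_lt.1 ha) with h | h <;> linarith [lt_of_abs_lt hb]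
  · simpa using hab

theorem pull_sub_pull_mul_le (a b : ℝ) : (pull a - pull b) * (a - b) ≤ (a - b) ^ 2 := by
  have := monovary_iff_forall_mul_nonneg.1 (monotone_sub_pull.monovary monotone_id) b a
  simp only [id_eq] at this
  linarith

variable {n : ℕ}

theorem field_eq_sum_pull (x : Fin n → ℝ) (i : Fin n) : field x i = ∑ j, pull (x j - x i) := by
  simp only [field, pull, Finset.sum_filter, abs_sub_comm (x i)]

theorem abs_field_le (x : Fin n → ℝ) (i : Fin n) : |field x i| ≤ n := by
  rw [field_eq_sum_pull]
  refine (Finset.abs_sum_le_sum_abs _ _).trans ?_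
  exact (Finset.sum_le_card_nsmul _ _ 1 fun j _ => abs_pull_le (x j - x i)).trans_eq (by simp)

theorem field_comp_perm (x : Fin n → ℝ) (σ : Equiv.Perm (Fin n)) (i : Fin n) :
    field (fun k => x (σ k)) i = field x (σ i) := by
  simp only [field_eq_sum_pull]
  exact Equiv.sum_comp σ fun j => pull (x j - x (σ i))

theorem sum_field_mul (x z : Fin n → ℝ) :
    ∑ i, field x i * z i = -(1 / 2) * ∑ i, ∑ j, pull (x j - x i) * (z j - z i) := by
  have hanti : ∑ i, ∑ j, pull (x j - x i) * z j = -∑ i, ∑ j, pull (x j - x i) * z i := by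
    rw [Finset.sum_comm]
    simp only [← Finset.sum_neg_distrib, ← neg_mul, ← pull_neg, neg_sub]
  simp only [mul_sub, Finset.sum_sub_distrib, hanti, field_eq_sum_pull, Finset.sum_mul]
  ring

theorem sum_field_mul_nonpos {x z : Fin n → ℝ}
    (h : ∀ i j, |x j - x i| < 1 → 0 ≤ (x j - x i) * (z j - z i)) : ∑ i, field x i * z i ≤ 0 := by
  have hnn : 0 ≤ ∑ i, ∑ j, pull (x j - x i) * (z j - z i) :=
    Finset.sum_nonneg fun i _ => Finset.sum_nonneg fun j _ => by
      rcases lt_or_ge |x j - x i| 1 with hlt | hge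
      · simpa only [pull_of_abs_lt hlt] using h i j hlt
      · rw [pull_of_le_abs hge, zero_mul]
  rw [sum_field_mul]
  linarith

theorem neg_mul_sum_sq_le_sum_field_sub_mul (x y : Fin n → ℝ) :
    -(2 * n * ∑ i, (x i - y i) ^ 2) ≤ ∑ i, (field x i - field y i) * (x i - y i) := by
  have hterm : ∀ i j, (pull (x j - x i) - pull (y j - y i)) * (x j - y j - (x i - y i)) ≤
      2 * ((x j - y j) ^ 2 + (x i - y i) ^ 2) := fun i j => by
    have h₁ := pull_sub_pull_mul_le (x j - x i) (y j - y i)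
    have h₂ := add_sq_le (a := x j - y j) (b := -(x i - y i))
    rw [sub_sub_sub_comm] at h₁
    rw [neg_sq] at h₂
    linarith
  have hsum := Finset.sum_le_sum fun i (_ : i ∈ Finset.univ) =>
    Finset.sum_le_sum fun j (_ : j ∈ Finset.univ) => hterm i j
  simp only [sub_mul, Finset.sum_sub_distrib, sum_field_mul, ← Finset.mul_sum,
    Finset.sum_add_distrib, Finset.sum_const, Finset.card_univ, Fintype.card_fin,
    nsmul_eq_mul] at hsum ⊢
  linarith

theorem sum_field_eq_sum_compl (x : Fin n → ℝ) (A : Finset (Fin n)) :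
    ∑ p ∈ A, field x p = ∑ p ∈ A, ∑ q ∈ Aᶜ, pull (x q - x p) := by
  have hinternal : ∑ p ∈ A, ∑ q ∈ A, pull (x q - x p) = 0 := by
    refine self_eq_neg.1 ?_
    conv_lhs => rw [Finset.sum_comm]
    simp only [← Finset.sum_neg_distrib, ← pull_neg, neg_sub]
  simp only [field_eq_sum_pull, ← Finset.sum_add_sum_compl A, Finset.sum_add_distrib, hinternal,
    zero_add]

theorem sum_field_nonneg {x : Fin n → ℝ} {A : Finset (Fin n)}
    (hA : ∀ p ∈ A, ∀ q ∉ A, x p ≤ x q) : 0 ≤ ∑ p ∈ A, field x p := by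
  rw [sum_field_eq_sum_compl]
  exact Finset.sum_nonneg fun p hp => Finset.sum_nonneg fun q hq =>
    pull_nonneg (sub_nonneg.2 (hA p hp q (Finset.mem_compl.1 hq)))

theorem pull_le_sum_field {x : Fin n → ℝ} {A : Finset (Fin n)}
    (hA : ∀ p ∈ A, ∀ q ∉ A, x p ≤ x q) {i j : Fin n} (hi : i ∈ A) (hj : j ∉ A) :
    pull (x j - x i) ≤ ∑ p ∈ A, field x p := by
  have hnn : ∀ p ∈ A, ∀ q ∈ Aᶜ, 0 ≤ pull (x q - x p) := fun p hp q hq =>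
    pull_nonneg (sub_nonneg.2 (hA p hp q (Finset.mem_compl.1 hq)))
  rw [sum_field_eq_sum_compl]
  calc pull (x j - x i) ≤ ∑ q ∈ Aᶜ, pull (x q - x i) :=
        Finset.single_le_sum (f := fun q => pull (x q - x i)) (hnn i hi) (Finset.mem_compl.2 hj)
    _ ≤ ∑ p ∈ A, ∑ q ∈ Aᶜ, pull (x q - x p) :=
        Finset.single_le_sum (f := fun p => ∑ q ∈ Aᶜ, pull (x q - x p))
          (fun p hp => Finset.sum_nonneg (hnn p hp)) hi

section Cluster

variable {x : Fin n → ℝ} {i j : Fin n}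

theorem mem_cluster : j ∈ cluster x i ↔ (interactionGraph x).Reachable i j := by
  simp [cluster]

theorem mem_cluster_comm : j ∈ cluster x i ↔ i ∈ cluster x j := by
  rw [mem_cluster, mem_cluster, SimpleGraph.reachable_comm]

theorem cluster_eq_of_reachable (h : (interactionGraph x).Reachable i j) :
    cluster x i = cluster x j := by
  ext k
  rw [mem_cluster, mem_cluster]
  exact ⟨h.symm.trans, h.trans⟩

theorem clusterMean_eq_of_reachable (h : (interactionGraph x).Reachable i j) :
    clusterMean x i = clusterMean x j := by
  unfold clusterMean
  rw [cluster_eq_of_reachable h]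

theorem card_cluster_pos (x : Fin n → ℝ) (i : Fin n) : 0 < (cluster x i).card :=
  Finset.card_pos.2 ⟨i, mem_cluster.2 (SimpleGraph.Reachable.refl i)⟩

theorem reachable_of_abs_lt (h : |x i - x j| < 1) : (interactionGraph x).Reachable i j := by
  rcases eq_or_ne i j with rfl | hij
  · exact SimpleGraph.Reachable.refl i
  · exact SimpleGraph.Adj.reachable (G := interactionGraph x) ⟨hij, h⟩

theorem eq_of_reachable {α : Type*} {c : Fin n → α} (hc : ∀ i j, |x i - x j| < 1 → c i = c j)
    (h : (interactionGraph x).Reachable i j) : c i = c j := by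
  obtain ⟨p⟩ := h
  induction p with
  | nil => rfl
  | cons hadj _ ih => exact (hc _ _ hadj.2).trans ih

theorem sum_mul_clusterMean {d : Fin n → ℝ}
    (hd : ∀ i j, (interactionGraph x).Reachable i j → d i = d j) :
    ∑ i, d i * clusterMean x i = ∑ i, d i * x i := by
  have hrow : ∀ i, d i * clusterMean x i =
      ∑ j, if j ∈ cluster x i then d j * x j / (cluster x j).card else 0 := fun i => by
    rw [clusterMean, Finset.sum_ite_mem, Finset.univ_inter, Finset.sum_div, Finset.mul_sum]
    refine Finset.sum_congr rfl fun j hj => ?_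
    rw [mem_cluster] at hj
    rw [hd i j hj, cluster_eq_of_reachable hj, mul_div_assoc]
  simp only [hrow]
  rw [Finset.sum_comm]
  refine Finset.sum_congr rfl fun j _ => ?_
  have hcard : ((cluster x j).card : ℝ) ≠ 0 := by exact_mod_cast (card_cluster_pos x j).ne'
  simp only [mem_cluster_comm (j := j), Finset.sum_ite_mem, Finset.univ_inter, Finset.sum_const,
    nsmul_eq_mul, mul_div_cancel₀ _ hcard]

theorem localVariance_le {c : Fin n → ℝ} (hc : ∀ i j, |x i - x j| < 1 → c i = c j) :
    localVariance x ≤ 1 / n * ∑ i, (x i - c i) ^ 2 := by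
  refine mul_le_mul_of_nonneg_left ?_ (by positivity)
  have horth := sum_mul_clusterMean (d := fun i => clusterMean x i - c i) fun i j h => by
    rw [clusterMean_eq_of_reachable h, eq_of_reachable hc h]
  have hdecomp : ∑ i, (x i - c i) ^ 2 = ∑ i, (x i - clusterMean x i) ^ 2 +
      2 * (∑ i, (clusterMean x i - c i) * x i - ∑ i, (clusterMean x i - c i) * clusterMean x i) +
      ∑ i, (clusterMean x i - c i) ^ 2 := by
    rw [← Finset.sum_sub_distrib, Finset.mul_sum, ← Finset.sum_add_distrib,
      ← Finset.sum_add_distrib]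
    exact Finset.sum_congr rfl fun i _ => by ring
  rw [hdecomp, horth, sub_self, mul_zero, add_zero]
  exact le_add_of_nonneg_right (Finset.sum_nonneg fun i _ => sq_nonneg _)

theorem localVariance_nonneg (x : Fin n → ℝ) : 0 ≤ localVariance x :=
  mul_nonneg (by positivity) (Finset.sum_nonneg fun _ _ => sq_nonneg _)

end Cluster

/-! ### Trajectories -/

namespace IsCaratheodorySolution

variable {t₀ : ℝ} {x y : ℝ → Fin n → ℝ}

theorem intervalIntegrable (hx : IsCaratheodorySolution t₀ x) (i : Fin n) {s t : ℝ}
    (hs : t₀ ≤ s) (ht : t₀ ≤ t) : IntervalIntegrable (fun τ => field (x τ) i) volume s t :=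
  (hx i s hs).1.symm.trans (hx i t ht).1

theorem sub_eq_integral (hx : IsCaratheodorySolution t₀ x) (i : Fin n) {s t : ℝ}
    (hs : t₀ ≤ s) (ht : t₀ ≤ t) : x t i - x s i = ∫ τ in s..t, field (x τ) i := by
  rw [(hx i t ht).2, (hx i s hs).2, add_sub_add_left_eq_sub,
    intervalIntegral.integral_interval_sub_left (hx i t ht).1 (hx i s hs).1]

theorem lipschitzOnWith (hx : IsCaratheodorySolution t₀ x) (i : Fin n) :
    LipschitzOnWith n (fun t => x t i) (Ici t₀) := by
  refine LipschitzOnWith.of_dist_le_mul fun s hs t ht => ?_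
  rw [Real.dist_eq, Real.dist_eq, hx.sub_eq_integral i ht hs]
  simpa using intervalIntegral.norm_integral_le_of_norm_le_const (a := t) (b := s)
    (f := fun τ => field (x τ) i) (C := n) fun τ _ => abs_field_le (x τ) i

theorem continuousOn (hx : IsCaratheodorySolution t₀ x) (i : Fin n) :
    ContinuousOn (fun t => x t i) (Ici t₀) := (hx.lipschitzOnWith i).continuousOn

theorem absolutelyContinuousOnInterval (hx : IsCaratheodorySolution t₀ x) (i : Fin n) {s t : ℝ}
    (hs : t₀ ≤ s) (ht : t₀ ≤ t) : AbsolutelyContinuousOnInterval (fun τ => x τ i) s t :=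
  ((hx.lipschitzOnWith i).mono fun _ hτ => (le_min hs ht).trans hτ.1).absolutelyContinuousOnInterval

theorem ae_hasDerivAt (hx : IsCaratheodorySolution t₀ x) :
    ∀ᵐ t, t₀ < t → ∀ i, HasDerivAt (fun t => x t i) (field (x t) i) t := by
  have hprim : ∀ i : Fin n, ∀ N : ℕ, ∀ᵐ t, t ∈ uIcc t₀ (t₀ + N) → ∀ c ∈ uIcc t₀ (t₀ + N),
      HasDerivAt (fun t => ∫ τ in c..t, field (x τ) i) (field (x t) i) t := fun i N =>
    (hx i (t₀ + N) (by simp)).1.ae_hasDerivAt_integral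
  filter_upwards [ae_all_iff.2 fun i => ae_all_iff.2 (hprim i)] with t ht h₀ i
  obtain ⟨N, hN⟩ := exists_nat_ge (t - t₀)
  have hderiv := ht i N (mem_uIcc_of_le h₀.le (sub_le_iff_le_add'.1 hN)) t₀ left_mem_uIcc
  refine (hderiv.const_add (x t₀ i)).congr_of_eventuallyEq ?_
  filter_upwards [Ioi_mem_nhds h₀] with s hs
  exact (hx i s (le_of_lt hs)).2

theorem shift (hx : IsCaratheodorySolution t₀ x) {c : ℝ} (hc : 0 ≤ c) :
    IsCaratheodorySolution t₀ (fun t => x (t + c)) := by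
  intro i t ht
  have hs : t₀ ≤ t₀ + c := le_add_of_nonneg_right hc
  have ht' : t₀ ≤ t + c := ht.trans (le_add_of_nonneg_right hc)
  refine ⟨by simpa using (hx.intervalIntegrable i hs ht').comp_add_right c, ?_⟩
  rw [intervalIntegral.integral_comp_add_right (fun τ => field (x τ) i),
    ← hx.sub_eq_integral i hs ht', add_sub_cancel]

theorem comp_perm (hx : IsCaratheodorySolution t₀ x) (σ : Equiv.Perm (Fin n)) :
    IsCaratheodorySolution t₀ (fun t i => x t (σ i)) := fun i t ht => by
  simpa only [field_comp_perm] using hx (σ i) t ht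

theorem sum_sq_sub_le (hx : IsCaratheodorySolution t₀ x) (hy : IsCaratheodorySolution t₀ y)
    {s t : ℝ} (hs : t₀ ≤ s) (hst : s ≤ t) :
    ∑ i, (x s i - y s i) ^ 2 ≤ Real.exp (4 * n * (t - s)) * ∑ i, (x t i - y t i) ^ 2 := by
  refine le_exp_mul_of_ae_hasDerivAt (f := fun τ => ∑ i, (x τ i - y τ i) ^ 2)
    (f' := fun τ => 2 * ∑ i, (field (x τ) i - field (y τ) i) * (x τ i - y τ i)) hst
    (absolutelyContinuousOnInterval_sum_sq _ fun i _ =>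
      (hx.absolutelyContinuousOnInterval i hs (hs.trans hst)).fun_sub
        (hy.absolutelyContinuousOnInterval i hs (hs.trans hst))) ?_ fun τ _ => ?_
  · filter_upwards [hx.ae_hasDerivAt, hy.ae_hasDerivAt] with τ hx' hy' hτ
    have hτ₀ := hs.trans_lt hτ.1
    exact hasDerivAt_sum_sq _ fun i _ => (hx' hτ₀ i).fun_sub (hy' hτ₀ i)
  · linarith [neg_mul_sum_sq_le_sum_field_sub_mul (x τ) (y τ)]

theorem eq_of_eq (hx : IsCaratheodorySolution t₀ x) (hy : IsCaratheodorySolution t₀ y)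
    {s t : ℝ} (hs : t₀ ≤ s) (hst : s ≤ t) (h : x t = y t) : x s = y s := by
  have hsum := hx.sum_sq_sub_le hy hs hst
  simp only [h, sub_self, ne_eq, OfNat.ofNat_ne_zero, not_false_eq_true, zero_pow,
    Finset.sum_const_zero, mul_zero] at hsum
  have hzero := (Finset.sum_eq_zero_iff_of_nonneg fun i _ => sq_nonneg _).1
    (hsum.antisymm (Finset.sum_nonneg fun i _ => sq_nonneg _))
  exact funext fun i => sub_eq_zero.1 (pow_eq_zero_iff two_ne_zero |>.1 (hzero i (by simp)))

/-- Interchanging two agents that have met leaves the configuration unchanged, so by backward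
uniqueness they have never been apart. -/
theorem ne_of_ne (hx : IsCaratheodorySolution t₀ x) {i j : Fin n} {s t : ℝ} (hs : t₀ ≤ s)
    (hst : s ≤ t) (h : x s i ≠ x s j) : x t i ≠ x t j := by
  intro heq
  have hswap : x t = fun k => x t (Equiv.swap i j k) := by
    funext k
    rw [Equiv.swap_apply_def]
    split_ifs with hki hkj <;> simp [*]
  have := congrFun (hx.eq_of_eq (hx.comp_perm (Equiv.swap i j)) hs hst hswap) i
  exact h (by simpa using this)

theorem lt_of_lt (hx : IsCaratheodorySolution t₀ x) {i j : Fin n} {s t : ℝ} (hs : t₀ ≤ s)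
    (hst : s ≤ t) (h : x s i < x s j) : x t i < x t j := by
  by_contra! hle
  have hcont : ContinuousOn (fun τ => x τ j - x τ i) (Icc s t) :=
    ((hx.continuousOn j).sub (hx.continuousOn i)).mono fun τ hτ => hs.trans hτ.1
  obtain ⟨τ, hτ, hmeet⟩ := intermediate_value_Icc' hst hcont
    (⟨sub_nonpos.2 hle, (sub_pos.2 h).le⟩ : (0 : ℝ) ∈ Icc _ _)
  exact hx.ne_of_ne hs hτ.1 h.ne (sub_eq_zero.1 hmeet).symm

theorem lt_iff_lt (hx : IsCaratheodorySolution t₀ x) {i j : Fin n} {s t : ℝ} (hs : t₀ ≤ s)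
    (hst : s ≤ t) (hne : x s i ≠ x s j) : x t i < x t j ↔ x s i < x s j :=
  ⟨fun h => hne.lt_or_gt.resolve_right fun hgt => h.asymm (hx.lt_of_lt hs hst hgt),
    hx.lt_of_lt hs hst⟩

theorem sum_sq_sub_const_le (hx : IsCaratheodorySolution t₀ x) {c : Fin n → ℝ} {s t : ℝ}
    (hs : t₀ ≤ s) (hst : s ≤ t)
    (hc : ∀ τ ∈ Icc s t, ∀ i j, |x τ i - x τ j| < 1 → c i = c j) :
    ∑ i, (x t i - c i) ^ 2 ≤ ∑ i, (x s i - c i) ^ 2 := by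
  have hac : AbsolutelyContinuousOnInterval (fun τ => ∑ i, (x τ i - c i) ^ 2) s t :=
    absolutelyContinuousOnInterval_sum_sq _ fun i _ =>
      (hx.absolutelyContinuousOnInterval i hs (hs.trans hst)).fun_sub
        (absolutelyContinuousOnInterval_const (c i) s t)
  refine neg_le_neg_iff.1 (le_of_ae_hasDerivAt_nonneg
    (f := fun τ => -∑ i, (x τ i - c i) ^ 2)
    (f' := fun τ => -(2 * ∑ i, field (x τ) i * (x τ i - c i)))
    hst hac.fun_neg ?_ fun τ hτ => ?_)
  · filter_upwards [hx.ae_hasDerivAt] with τ hx' hτ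
    exact (hasDerivAt_sum_sq _ fun i _ => (hx' (hs.trans_lt hτ.1) i).sub_const (c i)).fun_neg
  · have := sum_field_mul_nonpos (x := x τ) (z := fun i => x τ i - c i) fun i j h => by
      rw [hc τ (Ioo_subset_Icc_self hτ) j i h, sub_sub_sub_cancel_right]
      exact mul_self_nonneg _
    linarith

theorem exists_abs_le (hx : IsCaratheodorySolution t₀ x) :
    ∃ M, ∀ t, t₀ ≤ t → ∀ i, |x t i| ≤ M := by
  refine ⟨Real.sqrt (∑ i, x t₀ i ^ 2), fun t ht i => Real.abs_le_sqrt ?_⟩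
  calc x t i ^ 2 ≤ ∑ k, x t k ^ 2 :=
        Finset.single_le_sum (f := fun k => x t k ^ 2) (fun k _ => sq_nonneg _) (Finset.mem_univ i)
    _ ≤ ∑ k, x t₀ k ^ 2 := by
        simpa using hx.sum_sq_sub_const_le (c := fun _ => 0) le_rfl ht fun _ _ _ _ _ => rfl

end IsCaratheodorySolution

/-! ### Convergence -/

namespace IsCaratheodorySolution

variable {t₀ : ℝ} {x : ℝ → Fin n → ℝ}

theorem mul_sub_le_sum_sub_sum (hx : IsCaratheodorySolution t₀ x) {A : Finset (Fin n)}
    {s t C : ℝ} (hs : t₀ ≤ s) (hst : s ≤ t) (hC : ∀ τ ∈ Ioo s t, C ≤ ∑ p ∈ A, field (x τ) p) :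
    C * (t - s) ≤ ∑ p ∈ A, x t p - ∑ p ∈ A, x s p := by
  refine mul_sub_le_image_sub_of_ae_hasDerivAt hst (absolutelyContinuousOnInterval_sum A fun p _ =>
    hx.absolutelyContinuousOnInterval p hs (hs.trans hst)) ?_ hC
  filter_upwards [hx.ae_hasDerivAt] with τ hx' hτ
  exact HasDerivAt.fun_sum fun p _ => hx' (hs.trans_lt hτ.1) p

theorem exists_tendsto_sum (hx : IsCaratheodorySolution t₀ x) {A : Finset (Fin n)} {T : ℝ}
    (hT : t₀ ≤ T) (hA : ∀ p ∈ A, ∀ q ∉ A, x T p < x T q) :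
    ∃ S, Tendsto (fun t => ∑ p ∈ A, x t p) atTop (𝓝 S) := by
  obtain ⟨M, hM⟩ := hx.exists_abs_le
  have hmono : MonotoneOn (fun t => ∑ p ∈ A, x t p) (Ici T) := fun s hs t _ hst => by
    have hgrow := hx.mul_sub_le_sum_sub_sum (hT.trans hs) hst (C := 0) fun τ hτ =>
      sum_field_nonneg fun p hp q hq =>
        (hx.lt_of_lt hT (hs.trans hτ.1.le) (hA p hp q hq)).le
    rwa [zero_mul, sub_nonneg] at hgrow
  exact exists_tendsto_of_monotoneOn_Ici hmono fun t ht =>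
    Finset.sum_le_card_nsmul A _ M fun p _ => (le_abs_self _).trans (hM t (hT.trans ht) p)

theorem eventually_forall_lt_iff_lt (hx : IsCaratheodorySolution t₀ x) :
    ∀ᶠ T in atTop, ∀ i j, ∀ t ≥ T, x t i < x t j ↔ x T i < x T j := by
  simp only [eventually_all]
  intro i j
  by_cases h : ∃ s ≥ t₀, x s i < x s j
  · obtain ⟨s, hs, hlt⟩ := h
    filter_upwards [eventually_ge_atTop s] with T hT t ht
    exact iff_of_true (hx.lt_of_lt hs (hT.trans ht) hlt) (hx.lt_of_lt hs hT hlt)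
  · push Not at h
    filter_upwards [eventually_ge_atTop t₀] with T hT t ht
    exact iff_of_false (h t (hT.trans ht)).not_gt (h T hT).not_gt

theorem exists_tendsto (hx : IsCaratheodorySolution t₀ x) (i : Fin n) :
    ∃ ℓ, Tendsto (fun t => x t i) atTop (𝓝 ℓ) := by
  obtain ⟨T, horder, hT⟩ := (hx.eventually_forall_lt_iff_lt.and (eventually_ge_atTop t₀)).exists
  let A : Finset (Fin n) := {p | x T p ≤ x T i}
  let B : Finset (Fin n) := {p | x T p < x T i}
  have hBA : B ⊆ A := Finset.monotone_filter_right _ fun p _ => le_of_lt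
  obtain ⟨SA, hSA⟩ := hx.exists_tendsto_sum (A := A) hT fun p hp q hq => by
    simp only [A, Finset.mem_filter_univ, not_le] at hp hq
    exact hp.trans_lt hq
  obtain ⟨SB, hSB⟩ := hx.exists_tendsto_sum (A := B) hT fun p hp q hq => by
    simp only [B, Finset.mem_filter_univ, not_lt] at hp hq
    exact hp.trans_le hq
  have hcard : ((A \ B).card : ℝ) ≠ 0 :=
    Nat.cast_ne_zero.2 (Finset.card_ne_zero_of_mem (a := i) (by simp [A, B]))
  refine ⟨(SA - SB) / (A \ B).card, ((hSA.sub hSB).div_const _).congr' ?_⟩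
  filter_upwards [eventually_ge_atTop T] with t ht
  have heq : ∀ p ∈ A \ B, x t p = x t i := fun p hp => by
    simp only [A, B, Finset.mem_sdiff, Finset.mem_filter_univ] at hp
    exact le_antisymm (not_lt.1 fun h => hp.1.not_gt ((horder i p t ht).1 h))
      (not_lt.1 fun h => hp.2 ((horder p i t ht).1 h))
  rw [← Finset.sum_sdiff hBA, add_sub_cancel_right, Finset.sum_congr rfl heq, Finset.sum_const,
    nsmul_eq_mul, mul_div_cancel_left₀ _ hcard]

theorem one_le_sub_of_tendsto (hx : IsCaratheodorySolution t₀ x) {ℓ : Fin n → ℝ}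
    (hℓ : ∀ i, Tendsto (fun t => x t i) atTop (𝓝 (ℓ i))) {i j : Fin n} (hij : ℓ i < ℓ j) :
    1 ≤ ℓ j - ℓ i := by
  by_contra! hlt
  have hd : 0 < ℓ j - ℓ i := sub_pos.2 hij
  have hgap := (hℓ j).sub (hℓ i)
  obtain ⟨T, hT⟩ := eventually_atTop.1 ((eventually_ge_atTop t₀).and
    ((hgap.eventually (lt_mem_nhds (half_lt_self hd))).and (hgap.eventually (gt_mem_nhds hlt))))
  have hT₀ : t₀ ≤ T := (hT T le_rfl).1
  let A : Finset (Fin n) := {p | x T p ≤ x T i}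
  have hA : ∀ p ∈ A, ∀ q ∉ A, x T p < x T q := fun p hp q hq => by
    simp only [A, Finset.mem_filter_univ, not_le] at hp hq
    exact hp.trans_lt hq
  have hi : i ∈ A := by simp [A]
  have hj : j ∉ A := by
    simp only [A, Finset.mem_filter_univ, not_le]
    linarith [(hT T le_rfl).2.1]
  obtain ⟨S, hS⟩ := hx.exists_tendsto_sum hT₀ hA
  have hincr : ∀ t ≥ T, (ℓ j - ℓ i) / 2 ≤ ∑ p ∈ A, x (t + 1) p - ∑ p ∈ A, x t p := fun t ht => by
    have := hx.mul_sub_le_sum_sub_sum (A := A) (C := (ℓ j - ℓ i) / 2) (hT₀.trans ht)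
      (le_add_of_nonneg_right zero_le_one) fun τ hτ => by
        obtain ⟨-, hlow, hhigh⟩ := hT τ (ht.trans hτ.1.le)
        calc (ℓ j - ℓ i) / 2 ≤ pull (x τ j - x τ i) := by
              rw [pull_of_abs_lt (abs_lt.2 ⟨by linarith, hhigh⟩)]
              exact hlow.le
          _ ≤ ∑ p ∈ A, field (x τ) p := pull_le_sum_field (fun p hp q hq =>
              (hx.lt_of_lt hT₀ (ht.trans hτ.1.le) (hA p hp q hq)).le) hi hj
    simpa using this
  have hlim := (hS.comp (tendsto_atTop_add_const_right _ 1 tendsto_id)).sub hS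
  rw [sub_self] at hlim
  exact (half_pos hd).not_ge (ge_of_tendsto hlim ((eventually_ge_atTop T).mono hincr))

end IsCaratheodorySolution

section Overlap

open scoped Classical in
/-- The total amount by which agents with different reference points `ℓ` are closer than `1`,
the ordering of the agents being read off from `ℓ`. It vanishes once only agents with the same
reference point interact. -/
noncomputable def overlap (ℓ x : Fin n → ℝ) : ℝ :=
  ∑ p : Fin n × Fin n with ℓ p.1 < ℓ p.2, max 0 (1 - (x p.2 - x p.1))

open scoped Classical in
/-- The indicator of an interaction between `i` and an agent `j` with a higher reference point. -/
noncomputable def crossEdge (ℓ x : Fin n → ℝ) (i j : Fin n) : ℤ :=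
  if ℓ i < ℓ j ∧ x j - x i < 1 then 1 else 0

/-- The net number of agents with a different reference point that pull agent `i` upwards. It is
the value of `field x i` in the limit `x → ℓ` when all reference points are at distance at least
`1`, and its being an integer is what makes `overlap` monotone. -/
noncomputable def netCrossing (ℓ x : Fin n → ℝ) (i : Fin n) : ℤ :=
  ∑ j, (crossEdge ℓ x i j - crossEdge ℓ x j i)

variable {ℓ x : Fin n → ℝ}

theorem crossEdge_of_le {i j : Fin n} (h : ℓ j ≤ ℓ i) : crossEdge ℓ x i j = 0 :=
  if_neg fun h' => h.not_gt h'.1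

theorem overlap_nonneg (ℓ x : Fin n → ℝ) : 0 ≤ overlap ℓ x :=
  Finset.sum_nonneg fun _ _ => le_max_left _ _

theorem one_le_sub_of_overlap_eq_zero (h : overlap ℓ x = 0) {i j : Fin n} (hij : ℓ i < ℓ j) :
    1 ≤ x j - x i := by
  have hzero := (Finset.sum_eq_zero_iff_of_nonneg fun _ _ => le_max_left _ _).1 h (i, j)
    ((Finset.mem_filter_univ _).2 hij)
  exact sub_nonpos.1 (max_eq_left_iff.1 hzero)

theorem overlap_self (hsep : ∀ i j, ℓ i < ℓ j → 1 ≤ ℓ j - ℓ i) : overlap ℓ ℓ = 0 :=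
  Finset.sum_eq_zero fun p hp =>
    max_eq_left (sub_nonpos.2 (hsep p.1 p.2 ((Finset.mem_filter_univ p).1 hp)))

theorem continuous_overlap (ℓ : Fin n → ℝ) : Continuous (overlap ℓ) :=
  continuous_finsetSum _ fun _ _ => by fun_prop

theorem sum_crossEdge_mul_sub (ℓ x v : Fin n → ℝ) :
    ∑ p : Fin n × Fin n, (crossEdge ℓ x p.1 p.2 : ℝ) * (v p.1 - v p.2) =
      ∑ i, v i * netCrossing ℓ x i := by
  have hcomm : ∑ i, ∑ j, (crossEdge ℓ x i j : ℝ) * v j = ∑ i, ∑ j, (crossEdge ℓ x j i : ℝ) * v i :=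
    Finset.sum_comm
  simp only [Fintype.sum_prod_type, mul_sub, Finset.sum_sub_distrib, hcomm, netCrossing,
    Int.cast_sub, Int.cast_sum, mul_comm (v _), sub_mul, Finset.sum_mul]

theorem abs_pull_sub_crossEdge_le {ε : ℝ} (hε : ε < 1 / 2) (hx : ∀ i, |x i - ℓ i| ≤ ε)
    (hsep : ∀ i j, ℓ i < ℓ j → 1 ≤ ℓ j - ℓ i) (i j : Fin n) :
    |pull (x j - x i) - (crossEdge ℓ x i j - crossEdge ℓ x j i)| ≤ 2 * ε := by
  wlog hij : ℓ i ≤ ℓ j generalizing i j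
  · have := this j i (le_of_not_ge hij)
    rwa [← neg_sub (x j), pull_neg, ← neg_sub (crossEdge ℓ x i j : ℝ), ← neg_sub', abs_neg] at this
  have hi := abs_le.1 (hx i)
  have hj := abs_le.1 (hx j)
  rw [crossEdge_of_le hij, Int.cast_zero, sub_zero]
  rcases hij.eq_or_lt with heq | hlt
  · rw [crossEdge_of_le heq.ge, Int.cast_zero, sub_zero,
      pull_of_abs_lt (abs_lt.2 ⟨by linarith, by linarith⟩)]
    exact abs_le.2 ⟨by linarith, by linarith⟩
  · have hgap := hsep i j hlt
    rcases lt_or_ge (x j - x i) 1 with h | h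
    · rw [pull_of_abs_lt (abs_lt.2 ⟨by linarith, h⟩), crossEdge, if_pos ⟨hlt, h⟩, Int.cast_one]
      exact abs_le.2 ⟨by linarith, by linarith⟩
    · rw [pull_of_le_abs (h.trans (le_abs_self _)), crossEdge, if_neg fun h' => h.not_gt h'.2]
      simpa using (abs_nonneg _).trans (hx i)

theorem abs_field_sub_netCrossing_le {ε : ℝ} (hε : ε < 1 / 2) (hx : ∀ i, |x i - ℓ i| ≤ ε)
    (hsep : ∀ i j, ℓ i < ℓ j → 1 ≤ ℓ j - ℓ i) (i : Fin n) :
    |field x i - netCrossing ℓ x i| ≤ n * (2 * ε) := by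
  simp only [field_eq_sum_pull, netCrossing, Int.cast_sum, Int.cast_sub,
    ← Finset.sum_sub_distrib (fun j => pull (x j - x i))]
  refine (Finset.abs_sum_le_sum_abs _ _).trans ?_
  exact (Finset.sum_le_card_nsmul _ _ _ fun j _ =>
    abs_pull_sub_crossEdge_le hε hx hsep i j).trans_eq (by simp)

theorem mul_intCast_nonneg_of_abs_sub_le {v : ℝ} {k : ℤ} (h : |v - k| ≤ 1 / 2) : 0 ≤ v * k := by
  have hv := abs_le.1 h
  rcases lt_trichotomy k 0 with hk | rfl | hk
  · have hk' : (k : ℝ) ≤ -1 := by exact_mod_cast Int.le_sub_one_of_lt hk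
    exact mul_nonneg_of_nonpos_of_nonpos (by linarith) (by linarith)
  · simp
  · have hk' : (1 : ℝ) ≤ k := by exact_mod_cast hk
    exact mul_nonneg (by linarith) (by linarith)

end Overlap

namespace IsCaratheodorySolution

variable {t₀ : ℝ} {x : ℝ → Fin n → ℝ}

theorem lipschitzOnWith_max_zero_one_sub (hx : IsCaratheodorySolution t₀ x) (i j : Fin n) :
    LipschitzOnWith (n + n) (fun t => max 0 (1 - (x t j - x t i))) (Ici t₀) := by
  simpa [Function.comp_def] using (LipschitzWith.id.const_max (0 : ℝ)).comp_lipschitzOnWith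
    ((LipschitzWith.const (1 : ℝ)).lipschitzOnWith.sub
      ((hx.lipschitzOnWith j).sub (hx.lipschitzOnWith i)))

theorem absolutelyContinuousOnInterval_overlap (hx : IsCaratheodorySolution t₀ x)
    (ℓ : Fin n → ℝ) {s t : ℝ} (hs : t₀ ≤ s) (ht : t₀ ≤ t) :
    AbsolutelyContinuousOnInterval (fun τ => overlap ℓ (x τ)) s t :=
  absolutelyContinuousOnInterval_sum _ fun p _ =>
    ((hx.lipschitzOnWith_max_zero_one_sub p.1 p.2).mono fun _ hτ =>
      (le_min hs ht).trans hτ.1).absolutelyContinuousOnInterval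

theorem ae_hasDerivAt_overlap (hx : IsCaratheodorySolution t₀ x) (ℓ : Fin n → ℝ) :
    ∀ᵐ t, t₀ < t → HasDerivAt (fun τ => overlap ℓ (x τ))
      (∑ i, field (x t) i * netCrossing ℓ (x t) i) t := by
  have hdiff : ∀ᵐ t, ∀ i j, t ∈ Ici t₀ →
      DifferentiableWithinAt ℝ (fun τ => max 0 (1 - (x τ j - x τ i))) (Ici t₀) t :=
    ae_all_iff.2 fun i => ae_all_iff.2 fun j =>
      (hx.lipschitzOnWith_max_zero_one_sub i j).ae_differentiableWithinAt_of_mem_real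
  filter_upwards [hx.ae_hasDerivAt, hdiff] with t hx' hdiff ht
  have hsum : ∑ i, field (x t) i * netCrossing ℓ (x t) i =
      ∑ p : Fin n × Fin n with ℓ p.1 < ℓ p.2,
        if 0 < 1 - (x t p.2 - x t p.1) then -(field (x t) p.2 - field (x t) p.1) else 0 := by
    rw [← sum_crossEdge_mul_sub, Finset.sum_filter]
    refine Finset.sum_congr rfl fun p _ => ?_
    by_cases h : ℓ p.1 < ℓ p.2 <;> simp [crossEdge, h]
  rw [hsum]
  exact HasDerivAt.fun_sum fun p _ => hasDerivAt_max_zero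
    (((hx' ht p.2).fun_sub (hx' ht p.1)).const_sub 1)
    ((hdiff p.1 p.2 ht.le).differentiableAt (Ici_mem_nhds ht))

theorem eventually_overlap_eq_zero (hx : IsCaratheodorySolution t₀ x) {ℓ : Fin n → ℝ}
    (hℓ : ∀ i, Tendsto (fun t => x t i) atTop (𝓝 (ℓ i))) :
    ∀ᶠ t in atTop, overlap ℓ (x t) = 0 := by
  have hsep : ∀ i j, ℓ i < ℓ j → 1 ≤ ℓ j - ℓ i := fun i j => hx.one_le_sub_of_tendsto hℓ
  obtain ⟨ε, hε, hεhalf, hεn⟩ : ∃ ε > (0 : ℝ), ε < 1 / 2 ∧ n * (2 * ε) ≤ 1 / 2 := by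
    refine ⟨1 / (4 * (n + 1)), by positivity, ?_, ?_⟩
    · rw [div_lt_div_iff₀ (by positivity) two_pos]
      linarith [n.cast_nonneg (α := ℝ)]
    · field_simp
      linarith
  have hnear : ∀ᶠ t in atTop, ∀ i, |x t i - ℓ i| ≤ ε := eventually_all.2 fun i =>
    (Metric.tendsto_nhds.1 (hℓ i) ε hε).mono fun t ht => ht.le
  obtain ⟨T, hT⟩ := eventually_atTop.1 (hnear.and (eventually_ge_atTop t₀))
  have hmono : MonotoneOn (fun t => overlap ℓ (x t)) (Ici T) := fun s hs t _ hst => by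
    have hs₀ := (hT s hs).2
    refine le_of_ae_hasDerivAt_nonneg hst
      (hx.absolutelyContinuousOnInterval_overlap ℓ hs₀ (hs₀.trans hst))
      ((hx.ae_hasDerivAt_overlap ℓ).mono fun τ h hτ => h (hs₀.trans_lt hτ.1)) fun τ hτ => ?_
    exact Finset.sum_nonneg fun i _ => mul_intCast_nonneg_of_abs_sub_le
      ((abs_field_sub_netCrossing_le hεhalf (hT τ (hs.trans hτ.1.le)).1 hsep i).trans hεn)
  have hlim : Tendsto (fun t => overlap ℓ (x t)) atTop (𝓝 0) := by
    rw [← overlap_self hsep]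
    exact ((continuous_overlap ℓ).tendsto ℓ).comp (tendsto_pi_nhds.2 hℓ)
  filter_upwards [eventually_ge_atTop T] with t ht
  refine le_antisymm (ge_of_tendsto hlim ?_) (overlap_nonneg ℓ (x t))
  filter_upwards [eventually_ge_atTop t] with s hs
  exact hmono ht (ht.trans hs) hs

theorem tendsto_localVariance (hx : IsCaratheodorySolution t₀ x) :
    Tendsto (fun t => localVariance (x t)) atTop (𝓝 0) := by
  choose ℓ hℓ using hx.exists_tendsto
  have hbound : Tendsto (fun t => 1 / n * ∑ i, (x t i - ℓ i) ^ 2) atTop (𝓝 0) := by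
    simpa using (tendsto_finsetSum Finset.univ fun i _ =>
      ((hℓ i).sub_const (ℓ i)).pow 2).const_mul (1 / (n : ℝ))
  refine tendsto_of_tendsto_of_tendsto_of_le_of_le' tendsto_const_nhds hbound
    (Eventually.of_forall fun t => localVariance_nonneg (x t)) ?_
  filter_upwards [hx.eventually_overlap_eq_zero hℓ] with t ht
  refine localVariance_le fun i j hij => le_antisymm (not_lt.1 fun h => ?_) (not_lt.1 fun h => ?_)
  · exact (one_le_sub_of_overlap_eq_zero ht h).not_gt (lt_of_abs_lt hij)
  · exact (one_le_sub_of_overlap_eq_zero ht h).not_gt (by linarith [neg_lt_of_abs_lt hij])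

end IsCaratheodorySolution

/-! ### Generic trajectories -/

namespace IsCaratheodorySolution

variable {t₀ : ℝ} {x y : ℝ → Fin n → ℝ}

theorem dist_le (hx : IsCaratheodorySolution t₀ x) (hy : IsCaratheodorySolution t₀ y)
    {s t : ℝ} (hs : t₀ ≤ s) (hst : s ≤ t) :
    dist (x s) (y s) ≤ √(Real.exp (4 * n * (t - s)) * n) * dist (x t) (y t) := calc
  dist (x s) (y s) ≤ √(∑ i, (x s i - y s i) ^ 2) := dist_le_sqrt_sum_sq _ _
  _ ≤ √(Real.exp (4 * n * (t - s)) * (n * dist (x t) (y t) ^ 2)) :=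
      Real.sqrt_le_sqrt <| (hx.sum_sq_sub_le hy hs hst).trans <| by
        gcongr
        simpa using sum_sq_le_card_mul_dist_sq (x t) (y t)
  _ = √(Real.exp (4 * n * (t - s)) * n) * dist (x t) (y t) := by
      rw [← mul_assoc, Real.sqrt_mul (by positivity), Real.sqrt_sq dist_nonneg]

theorem dist_time_le (hx : IsCaratheodorySolution t₀ x) {s t : ℝ} (hs : t₀ ≤ s) (ht : t₀ ≤ t) :
    dist (x s) (x t) ≤ n * dist s t :=
  (dist_pi_le_iff (by positivity)).2 fun i => by
    simpa using (hx.lipschitzOnWith i).dist_le_mul s hs t ht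

theorem dist_initial_le (hx : IsCaratheodorySolution t₀ x) (hy : IsCaratheodorySolution t₀ y)
    {T s r : ℝ} (hs : s ∈ Icc t₀ T) (hr : r ∈ Icc t₀ T) :
    dist (x t₀) (y t₀) ≤
      (n + √(Real.exp (4 * n * (T - t₀)) * n)) * dist (s, x s) (r, y r) := by
  wlog hrs : r ≤ s generalizing x y s r
  · rw [dist_comm (x t₀), dist_comm (s, x s)]
    exact this hy hx hr hs (le_of_not_ge hrs)
  have hshift : 0 ≤ s - r := sub_nonneg.2 hrs
  have htime : dist (x t₀) (x (t₀ + (s - r))) ≤ n * dist s r := by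
    have := hx.dist_time_le le_rfl (le_add_of_nonneg_right hshift)
    rwa [dist_self_add_right, Real.norm_eq_abs, ← Real.dist_eq] at this
  have hspace : dist (x (t₀ + (s - r))) (y t₀) ≤
      √(Real.exp (4 * n * (r - t₀)) * n) * dist (x s) (y r) := by
    simpa using (hx.shift hshift).dist_le hy le_rfl hr.1
  calc dist (x t₀) (y t₀)
    _ ≤ n * dist s r + √(Real.exp (4 * n * (r - t₀)) * n) * dist (x s) (y r) :=
        (dist_triangle _ _ _).trans (add_le_add htime hspace)
    _ ≤ n * dist (s, x s) (r, y r) +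
          √(Real.exp (4 * n * (T - t₀)) * n) * dist (s, x s) (r, y r) := by
        gcongr
        · exact le_max_left _ _
        · exact hr.2
        · exact le_max_right _ _
    _ = _ := (add_mul _ _ _).symm

end IsCaratheodorySolution

section NullSets

variable {F : Type*} [AddCommGroup F] [Module ℝ F] {L : (Fin n → ℝ) →ₗ[ℝ] F}

theorem ae_forall_solution_ne {t₀ t : ℝ} (ht : t₀ ≤ t) (hL : Function.Surjective L)
    (hF : 0 < Module.finrank ℝ F) (c : F) :
    ∀ᵐ x₀ : Fin n → ℝ, ∀ x, IsCaratheodorySolution t₀ x → x t₀ = x₀ → L (x t) ≠ c := by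
  rw [ae_iff]
  push Not
  set S : Set (Fin n → ℝ) := {x₀ | ∃ x, IsCaratheodorySolution t₀ x ∧ x t₀ = x₀ ∧ L (x t) = c}
  choose X hX hX₀ hXc using fun p : S => p.2
  refine volume_eq_zero_of_antilipschitz_of_fiber L hL (by simpa) (f := fun p => X p t)
    (K := ⟨√(Real.exp (4 * n * (t - t₀)) * n), Real.sqrt_nonneg _⟩) ?_ hXc
  refine AntilipschitzWith.of_le_mul_dist fun p q => ?_
  rw [Subtype.dist_eq, ← hX₀ p, ← hX₀ q]
  exact (hX p).dist_le (hX q) le_rfl ht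

theorem ae_forall_solution_forall_ne (t₀ : ℝ) (hL : Function.Surjective L)
    (hF : 1 < Module.finrank ℝ F) (c : F) :
    ∀ᵐ x₀ : Fin n → ℝ, ∀ x, IsCaratheodorySolution t₀ x → x t₀ = x₀ →
      ∀ t, t₀ ≤ t → L (x t) ≠ c := by
  have hbounded : ∀ N : ℕ, ∀ᵐ x₀ : Fin n → ℝ, ∀ x, IsCaratheodorySolution t₀ x → x t₀ = x₀ →
      ∀ t ∈ Icc t₀ (t₀ + N), L (x t) ≠ c := by
    intro N
    rw [ae_iff]
    push Not
    set S : Set (Fin n → ℝ) := {x₀ | ∃ x, IsCaratheodorySolution t₀ x ∧ x t₀ = x₀ ∧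
      ∃ t ∈ Icc t₀ (t₀ + N), L (x t) = c}
    choose X hX hX₀ τ hτ hXc using fun p : S => p.2
    refine volume_eq_zero_of_antilipschitz_of_fiber (L ∘ₗ LinearMap.snd ℝ ℝ (Fin n → ℝ))
      (hL.comp Prod.snd_surjective) (by simp; omega) (f := fun p => (τ p, X p (τ p)))
      (K := ⟨n + √(Real.exp (4 * n * (t₀ + N - t₀)) * n), by positivity⟩) ?_ hXc
    refine AntilipschitzWith.of_le_mul_dist fun p q => ?_
    rw [Subtype.dist_eq, ← hX₀ p, ← hX₀ q]
    exact (hX p).dist_initial_le (hX q) (hτ p) (hτ q)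
  filter_upwards [ae_all_iff.2 hbounded] with x₀ h x hx hx₀ t ht
  obtain ⟨N, hN⟩ := exists_nat_ge (t - t₀)
  exact h N x hx hx₀ t ⟨ht, sub_le_iff_le_add'.1 hN⟩

end NullSets

/-- The signed gap from agent `i` to agent `j`. It is a linear form, so that generic trajectories
can be described as avoiding affine subspaces. -/
def gap (i j : Fin n) : (Fin n → ℝ) →ₗ[ℝ] ℝ :=
  LinearMap.proj (R := ℝ) (φ := fun _ : Fin n => ℝ) j - LinearMap.proj i

@[simp] theorem gap_apply (i j : Fin n) (x : Fin n → ℝ) : gap i j x = x j - x i := rfl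

/-- The speed at which agents `i` and `j` are drawn apart when `i` is attracted by the agents of
`I` and `j` by those of `J`. -/
noncomputable def spread (i j : Fin n) (I J : Finset (Fin n)) : (Fin n → ℝ) →ₗ[ℝ] ℝ :=
  ∑ m ∈ J, gap j m - ∑ m ∈ I, gap i m

theorem spread_apply (i j : Fin n) (I J : Finset (Fin n)) (x : Fin n → ℝ) :
    spread i j I J x = ∑ m ∈ J, (x m - x j) - ∑ m ∈ I, (x m - x i) := by
  simp [spread, LinearMap.sub_apply, LinearMap.sum_apply]

theorem surjective_gap {i j : Fin n} (hij : i ≠ j) : Function.Surjective (gap i j) := fun c =>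
  ⟨Pi.single j c, by simp [hij]⟩

theorem surjective_gap_prod_gap {i j a b : Fin n} (hij : i ≠ j) (hab : a ≠ b)
    (h : s(a, b) ≠ s(i, j)) : Function.Surjective ((gap i j).prod (gap a b)) := by
  have hu : gap i j (Pi.single j 1) ≠ 0 := by simp [hij]
  obtain ⟨ha₁, ha₂⟩ | ⟨hb₁, hb₂⟩ : (a ≠ i ∧ a ≠ j) ∨ (b ≠ i ∧ b ≠ j) := by
    grind [Sym2.eq_iff]
  · exact surjective_prod_of_ne_zero _ _ hu (v := Pi.single a 1) (by simp [*, Ne.symm])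
      (by simp [hab.symm])
  · exact surjective_prod_of_ne_zero _ _ hu (v := Pi.single b 1) (by simp [*, Ne.symm])
      (by simp [hab])

theorem surjective_gap_prod_spread {i j m : Fin n} {I J : Finset (Fin n)} (hij : i ≠ j)
    (hmi : m ≠ i) (hmj : m ≠ j) (hm : ¬(m ∈ I ↔ m ∈ J)) :
    Function.Surjective ((gap i j).prod (spread i j I J)) := by
  refine surjective_prod_of_ne_zero _ _ (u := Pi.single j 1) (v := Pi.single m 1) (by simp [hij])
    (by simp [hmi.symm, hmj.symm]) ?_
  by_cases hI : m ∈ I <;> by_cases hJ : m ∈ J <;>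
    simp [spread_apply, hI, hJ, hmi.symm, hmj.symm, Pi.single_apply] at hm ⊢

/-- A trajectory in general position with respect to the thresholds `|x i - x j| = 1` of the
dynamics: no two agents start together, no threshold is met at a rational offset from the initial
time, two thresholds are never met together, and no threshold is met tangentially: the speed
`spread - 2` with which the gap closes up to `1` does not vanish. In `tangency` the agent `m` makes
`spread` linearly independent of `gap`. -/
structure IsGeneric (t₀ : ℝ) (x : ℝ → Fin n → ℝ) : Prop where
  injective : Function.Injective (x t₀)
  gap_ne_one : ∀ q : ℚ, 0 ≤ q → ∀ i j, i ≠ j → gap i j (x (t₀ + q)) ≠ 1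
  pairs : ∀ i j a b, i ≠ j → a ≠ b → s(a, b) ≠ s(i, j) → ∀ t, t₀ ≤ t →
    gap i j (x t) = 1 → gap a b (x t) ≠ 1
  tangency : ∀ i j m I J, i ≠ j → m ≠ i → m ≠ j → ¬(m ∈ I ↔ m ∈ J) → ∀ t, t₀ ≤ t →
    gap i j (x t) = 1 → spread i j I J (x t) ≠ 2

theorem ae_isGeneric (t₀ : ℝ) : ∀ᵐ x₀ : Fin n → ℝ, ∀ x, IsCaratheodorySolution t₀ x →
    x t₀ = x₀ → IsGeneric t₀ x := by
  have hinj : ∀ᵐ x₀ : Fin n → ℝ, ∀ i j, i ≠ j → ∀ x, IsCaratheodorySolution t₀ x →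
      x t₀ = x₀ → gap i j (x t₀) ≠ 0 := by
    simp only [eventually_all]
    exact fun i j hij => ae_forall_solution_ne le_rfl (surjective_gap hij) (by simp) 0
  have hgap : ∀ᵐ x₀ : Fin n → ℝ, ∀ q : ℚ, 0 ≤ q → ∀ i j, i ≠ j → ∀ x,
      IsCaratheodorySolution t₀ x → x t₀ = x₀ → gap i j (x (t₀ + q)) ≠ 1 := by
    refine ae_all_iff.2 fun q => ?_
    simp only [eventually_all]
    exact fun hq i j hij => ae_forall_solution_ne (by simpa using hq) (surjective_gap hij)
      (by simp) 1
  have hpairs : ∀ᵐ x₀ : Fin n → ℝ, ∀ i j a b, i ≠ j → a ≠ b → s(a, b) ≠ s(i, j) → ∀ x,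
      IsCaratheodorySolution t₀ x → x t₀ = x₀ →
        ∀ t, t₀ ≤ t → (gap i j).prod (gap a b) (x t) ≠ (1, 1) := by
    simp only [eventually_all]
    exact fun i j a b hij hab h =>
      ae_forall_solution_forall_ne t₀ (surjective_gap_prod_gap hij hab h) (by simp) _
  have htangency : ∀ᵐ x₀ : Fin n → ℝ, ∀ i j m I J, i ≠ j → m ≠ i → m ≠ j →
      ¬(m ∈ I ↔ m ∈ J) → ∀ x, IsCaratheodorySolution t₀ x → x t₀ = x₀ →
        ∀ t, t₀ ≤ t → (gap i j).prod (spread i j I J) (x t) ≠ (1, 2) := by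
    simp only [eventually_all]
    exact fun i j m I J hij hmi hmj hm =>
      ae_forall_solution_forall_ne t₀ (surjective_gap_prod_spread hij hmi hmj hm) (by simp) _
  filter_upwards [hinj, hgap, hpairs, htangency] with x₀ hinj hgap hpairs htangency x hx hx₀
  exact
    { injective := fun i j h => by_contra fun hij => hinj i j hij x hx hx₀ (sub_eq_zero.2 h.symm)
      gap_ne_one := fun q hq i j hij => hgap q hq i j hij x hx hx₀
      pairs := fun i j a b hij hab h t ht h₁ h₂ =>
        hpairs i j a b hij hab h x hx hx₀ t ht (Prod.ext h₁ h₂)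
      tangency := fun i j m I J hij hmi hmj hm t ht h₁ h₂ =>
        htangency i j m I J hij hmi hmj hm x hx hx₀ t ht (Prod.ext h₁ h₂) }

theorem one_le_of_ae_hasDerivAt_sub_pull {g v : ℝ → ℝ} {a b : ℝ} (hab : a ≤ b)
    (hg : AbsolutelyContinuousOnInterval g a b)
    (hg' : ∀ᵐ t, t ∈ Ioo a b → HasDerivAt g (v t - 2 * pull (g t)) t)
    (hpos : ∀ t ∈ Ioo a b, 0 < g t) (hv : ∀ t ∈ Ioo a b, v t ≤ 2 * g t) (hb : g b = 1) :
    1 ≤ g a := by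
  by_contra! ha
  obtain ⟨c, hc, hgc, hlt⟩ := exists_first_eq hab (uIcc_of_le hab ▸ hg.continuousOn) ha.le hb.ge
  have hsub : Ioo a c ⊆ Ioo a b := Ioo_subset_Ioo_right hc.2
  have hac : AbsolutelyContinuousOnInterval g a c := hg.mono <| by
    rw [uIcc_of_le hab, uIcc_of_le hc.1]
    exact Icc_subset_Icc_right hc.2
  have hle := le_of_ae_hasDerivAt_nonneg (f := fun t => -g t)
    (f' := fun t => -(v t - 2 * pull (g t))) hc.1 hac.fun_neg
    (hg'.mono fun t ht hmem => (ht (hsub hmem)).fun_neg) fun t ht => by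
      have hone : |g t| < 1 := by
        rw [abs_of_pos (hpos t (hsub ht))]
        exact hlt t (Ioo_subset_Ico_self ht)
      rw [pull_of_abs_lt hone]
      linarith [hv t (hsub ht)]
  linarith

theorem eq_one_of_ae_hasDerivAt_sub_pull {g v : ℝ → ℝ} {a b : ℝ} (hab : a ≤ b)
    (hg : AbsolutelyContinuousOnInterval g a b)
    (hg' : ∀ᵐ t, t ∈ Ioo a b → HasDerivAt g (v t - 2 * pull (g t)) t)
    (hpos : ∀ t ∈ Ioo a b, 0 < g t) (hv₀ : ∀ t ∈ Ioo a b, 0 ≤ v t)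
    (hv : ∀ t ∈ Ioo a b, v t ≤ 2 * g t) (hb : g b = 1) : g a = 1 := by
  have hone : ∀ t ∈ Icc a b, 1 ≤ g t := fun t ht => by
    have hsub : Ioo t b ⊆ Ioo a b := Ioo_subset_Ioo_left ht.1
    have hac : AbsolutelyContinuousOnInterval g t b := hg.mono <| by
      rw [uIcc_of_le hab, uIcc_of_le ht.2]
      exact Icc_subset_Icc_left ht.1
    exact one_le_of_ae_hasDerivAt_sub_pull ht.2 hac (hg'.mono fun τ hτ hmem => hτ (hsub hmem))
      (fun τ hτ => hpos τ (hsub hτ)) (fun τ hτ => hv τ (hsub hτ)) hb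
  refine le_antisymm ?_ (hone a (left_mem_Icc.2 hab))
  rw [← hb]
  refine le_of_ae_hasDerivAt_nonneg hab hg hg' fun t ht => ?_
  rw [pull_of_le_abs ((hone t (Ioo_subset_Icc_self ht)).trans (le_abs_self _)), mul_zero, sub_zero]
  exact hv₀ t ht

section Configuration

variable {x : Fin n → ℝ} {i j : Fin n} {I J : Finset (Fin n)}

open scoped Classical in
/-- The agents that attract agent `i`, together with `i` itself. -/
noncomputable def neighbors (x : Fin n → ℝ) (i : Fin n) : Finset (Fin n) := {j | |x i - x j| < 1}

theorem mem_neighbors : j ∈ neighbors x i ↔ |x i - x j| < 1 := by simp [neighbors]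

theorem le_of_mem_neighbors_left {m : Fin n} (hij : 1 ≤ gap i j x) (hm : x m ≤ x i ∨ x j ≤ x m)
    (h : m ∈ neighbors x i) : x m ≤ x i :=
  hm.resolve_right fun hjm => by
    linarith [gap_apply i j x, neg_lt_of_abs_lt (mem_neighbors.1 h)]

theorem le_of_mem_neighbors_right {m : Fin n} (hij : 1 ≤ gap i j x) (hm : x m ≤ x i ∨ x j ≤ x m)
    (h : m ∈ neighbors x j) : x j ≤ x m :=
  hm.resolve_left fun hmi => by
    linarith [gap_apply i j x, lt_of_abs_lt (mem_neighbors.1 h)]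

theorem field_eq_sum_add_pull (hj : j ∉ I) (hI : ∀ m, m ≠ j → (m ∈ neighbors x i ↔ m ∈ I)) :
    field x i = ∑ m ∈ I, (x m - x i) + pull (x j - x i) := by
  have hfield : field x i = ∑ m ∈ neighbors x i, (x m - x i) := rfl
  by_cases hmem : j ∈ neighbors x i
  · have hinsert : neighbors x i = insert j I := by
      ext m
      rcases eq_or_ne m j with rfl | hm <;> simp [*]
    rw [mem_neighbors, abs_sub_comm] at hmem
    rw [hfield, hinsert, Finset.sum_insert hj, pull_of_abs_lt hmem, add_comm]
  · have heq : neighbors x i = I := by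
      ext m
      rcases eq_or_ne m j with rfl | hm <;> simp [*]
    rw [mem_neighbors, abs_sub_comm, not_lt] at hmem
    rw [hfield, heq, pull_of_le_abs hmem, add_zero]

theorem field_sub_field_eq_spread_sub (hi : i ∉ J) (hj : j ∉ I)
    (hI : ∀ m, m ≠ j → (m ∈ neighbors x i ↔ m ∈ I))
    (hJ : ∀ m, m ≠ i → (m ∈ neighbors x j ↔ m ∈ J)) :
    field x j - field x i = spread i j I J x - 2 * pull (gap i j x) := by
  rw [field_eq_sum_add_pull hi hJ, field_eq_sum_add_pull hj hI, ← neg_sub (x j), pull_neg,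
    spread_apply, gap_apply]
  ring

theorem spread_nonneg (hI : ∀ m ∈ I, x m ≤ x i) (hJ : ∀ m ∈ J, x j ≤ x m) :
    0 ≤ spread i j I J x := by
  rw [spread_apply, sub_nonneg]
  exact (Finset.sum_nonpos fun m hm => sub_nonpos.2 (hI m hm)).trans
    (Finset.sum_nonneg fun m hm => sub_nonneg.2 (hJ m hm))

theorem exists_mem_not_iff_mem_of_spread_ne_zero (hij : x i < x j) (hI : ∀ m ∈ I, x m ≤ x i)
    (hJ : ∀ m ∈ J, x j ≤ x m) (h : spread i j I J x ≠ 0) :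
    ∃ m, m ≠ i ∧ m ≠ j ∧ ¬(m ∈ I ↔ m ∈ J) := by
  by_contra! hiff
  refine h ?_
  rw [spread_apply, Finset.sum_eq_zero fun m hm => ?_, Finset.sum_eq_zero fun m hm => ?_, sub_zero]
  · by_contra hne
    have hmi : m ≠ i := fun e => hne (by rw [e, sub_self])
    have hmj : m ≠ j := fun e => (hI m hm).not_gt (e ▸ hij)
    exact (hij.trans_le (hJ m ((hiff m hmi hmj).1 hm))).not_ge (hI m hm)
  · by_contra hne
    have hmj : m ≠ j := fun e => hne (by rw [e, sub_self])
    have hmi : m ≠ i := fun e => (hJ m hm).not_gt (e ▸ hij)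
    exact (hij.trans_le (hJ m hm)).not_ge (hI m ((hiff m hmi hmj).2 hm))

theorem exists_consecutive_gap (hij : x i ≤ x j) (h : ¬(interactionGraph x).Reachable i j) :
    ∃ k l, x i ≤ x k ∧ x l ≤ x j ∧ 1 ≤ gap k l x ∧ ∀ m, x m ≤ x k ∨ x l ≤ x m := by
  obtain ⟨k, ⟨hik, hkj⟩, hk⟩ := (toFinite {k | (interactionGraph x).Reachable i k ∧ x k ≤ x j})
    |>.exists_maximalFor x _ ⟨i, SimpleGraph.Reachable.refl i, hij⟩
  have hfar : ∀ l, x k < x l → x l ≤ x j → 1 ≤ x l - x k := fun l hkl hlj => by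
    by_contra! hlt
    have hadj : |x k - x l| < 1 := by rwa [abs_sub_comm, abs_of_pos (sub_pos.2 hkl)]
    exact hkl.not_ge (hk ⟨hik.trans (reachable_of_abs_lt hadj), hlj⟩ hkl.le)
  have hlt : x k < x j := hkj.lt_of_ne fun e =>
    h (hik.trans (reachable_of_abs_lt (by simp [e])))
  obtain ⟨l, hkl, hl⟩ := (toFinite {l | x k < x l}).exists_minimalFor x _ ⟨j, hlt⟩
  have hleast : ∀ m, x k < x m → x l ≤ x m := fun m hm => le_of_not_gt fun hlt =>
    hlt.not_ge (hl hm hlt.le)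
  exact ⟨k, l, le_of_not_gt fun hki => hki.not_ge (hk ⟨SimpleGraph.Reachable.refl i, hij⟩ hki.le),
    hleast j hlt, hfar l hkl (hleast j hlt), fun m => (le_or_gt (x m) (x k)).imp_right (hleast m)⟩

end Configuration

theorem eventually_mem_neighbors_iff {X : Type*} [TopologicalSpace X] {y : X → Fin n → ℝ} {s : X}
    (hy : ContinuousAt y s) {i j : Fin n} (h : |y s i - y s j| ≠ 1) :
    ∀ᶠ t in 𝓝 s, (j ∈ neighbors (y t) i ↔ j ∈ neighbors (y s) i) := by
  simp only [mem_neighbors]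
  rw [continuousAt_pi] at hy
  have hcont : ContinuousAt (fun t => |y t i - y t j|) s := ((hy i).sub (hy j)).abs
  rcases h.lt_or_gt with hlt | hgt
  · filter_upwards [hcont.eventually (gt_mem_nhds hlt)] with t ht
    exact iff_of_true ht hlt
  · filter_upwards [hcont.eventually (lt_mem_nhds hgt)] with t ht
    exact iff_of_false ht.not_gt hgt.not_gt

theorem eventually_field_sub_field_eq {X : Type*} [TopologicalSpace X] {y : X → Fin n → ℝ} {s : X}
    (hy : ContinuousAt y s) {i j : Fin n} (hij : gap i j (y s) = 1)
    (hpairs : ∀ a b, s(a, b) ≠ s(i, j) → |y s a - y s b| ≠ 1) :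
    ∀ᶠ t in 𝓝 s, field (y t) j - field (y t) i =
      spread i j (neighbors (y s) i) (neighbors (y s) j) (y t) - 2 * pull (gap i j (y t)) := by
  have hne : i ≠ j := by
    rintro rfl
    simp at hij
  have hev : ∀ᶠ t in 𝓝 s, ∀ a b, s(a, b) ≠ s(i, j) →
      (b ∈ neighbors (y t) a ↔ b ∈ neighbors (y s) a) := by
    simp only [eventually_all]
    exact fun a b hab => eventually_mem_neighbors_iff hy (hpairs a b hab)
  rw [gap_apply] at hij
  filter_upwards [hev] with t ht
  exact field_sub_field_eq_spread_sub (by simp [mem_neighbors, hij])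
    (by simp [mem_neighbors, abs_sub_comm (y s i), hij])
    (fun m hm => ht i m (by grind [Sym2.eq_iff])) (fun m hm => ht j m (by grind [Sym2.eq_iff]))

namespace IsGeneric

variable {t₀ s : ℝ} {x : ℝ → Fin n → ℝ} {i j : Fin n} {I J : Finset (Fin n)}

theorem abs_sub_ne_one (hg : IsGeneric t₀ x) (hs : t₀ ≤ s) (hij : gap i j (x s) = 1) {a b : Fin n}
    (hab : s(a, b) ≠ s(i, j)) : |x s a - x s b| ≠ 1 := by
  intro h
  have hne : i ≠ j := by
    rintro rfl
    simp at hij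
  have hne' : a ≠ b := by
    rintro rfl
    simp at h
  rcases eq_or_eq_neg_of_abs_eq h with h | h
  · exact hg.pairs i j b a hne hne'.symm (Sym2.eq_swap ▸ hab) s hs hij h
  · exact hg.pairs i j a b hne hne' hab s hs hij (by rw [gap_apply]; linarith)

theorem spread_ne_two (hg : IsGeneric t₀ x) (hs : t₀ ≤ s) (hij : gap i j (x s) = 1)
    (hI : ∀ m ∈ I, x s m ≤ x s i) (hJ : ∀ m ∈ J, x s j ≤ x s m) : spread i j I J (x s) ≠ 2 := by
  intro h
  have hlt : x s i < x s j := by linarith [gap_apply i j (x s)]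
  obtain ⟨m, hmi, hmj, hm⟩ :=
    exists_mem_not_iff_mem_of_spread_ne_zero hlt hI hJ (h ▸ two_ne_zero)
  exact hg.tangency i j m I J (fun e => hlt.ne (e ▸ rfl)) hmi hmj hm s hs hij h

end IsGeneric

namespace IsCaratheodorySolution

variable {t₀ r s t : ℝ} {x : ℝ → Fin n → ℝ} {i j : Fin n}

theorem le_iff_le (hx : IsCaratheodorySolution t₀ x) (hinj : Function.Injective (x t₀))
    (hs : t₀ ≤ s) (ht : t₀ ≤ t) : x s i ≤ x s j ↔ x t i ≤ x t j := by
  rcases eq_or_ne i j with rfl | hij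
  · simp
  · have hne : x t₀ j ≠ x t₀ i := hinj.ne hij.symm
    rw [← not_lt, ← not_lt, hx.lt_iff_lt le_rfl hs hne, hx.lt_iff_lt le_rfl ht hne]

theorem continuousAt (hx : IsCaratheodorySolution t₀ x) (hs : t₀ < s) : ContinuousAt x s :=
  continuousAt_pi.2 fun i => (hx.continuousOn i).continuousAt (Ici_mem_nhds hs)

theorem absolutelyContinuousOnInterval_gap (hx : IsCaratheodorySolution t₀ x) (i j : Fin n)
    (hs : t₀ ≤ s) (ht : t₀ ≤ t) : AbsolutelyContinuousOnInterval (fun τ => gap i j (x τ)) s t :=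
  (hx.absolutelyContinuousOnInterval j hs ht).fun_sub (hx.absolutelyContinuousOnInterval i hs ht)

theorem ae_hasDerivAt_gap (hx : IsCaratheodorySolution t₀ x) (hs : t₀ ≤ s) {f : ℝ → ℝ}
    (hf : ∀ τ ∈ Ioo s t, field (x τ) j - field (x τ) i = f τ) :
    ∀ᵐ τ, τ ∈ Ioo s t → HasDerivAt (fun τ => gap i j (x τ)) (f τ) τ := by
  filter_upwards [hx.ae_hasDerivAt] with τ hderiv hτ
  rw [← hf τ hτ]
  exact (hderiv (hs.trans_lt hτ.1) j).fun_sub (hderiv (hs.trans_lt hτ.1) i)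

theorem eventually_one_le_gap (hx : IsCaratheodorySolution t₀ x) {v : ℝ → ℝ} (hs : t₀ ≤ s)
    (hij : gap i j (x s) = 1) (hv : ContinuousAt v s) (htwo : 2 < v s)
    (hfield : ∀ᶠ t in 𝓝 s, field (x t) j - field (x t) i = v t - 2 * pull (gap i j (x t))) :
    ∀ᶠ t in 𝓝[>] s, 1 ≤ gap i j (x t) := by
  obtain ⟨b, hb, hsub⟩ := exists_Ico_subset_of_mem_nhds
    (hfield.and (hv.eventually (lt_mem_nhds htwo))) ⟨s + 1, lt_add_one s⟩
  filter_upwards [Ioo_mem_nhdsGT hb] with t ht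
  have hsub' : ∀ τ ∈ Ioo s t, τ ∈ Ico s b := fun τ hτ => ⟨hτ.1.le, hτ.2.trans ht.2⟩
  rw [← hij]
  refine le_of_ae_hasDerivAt_nonneg (f := fun τ => gap i j (x τ)) ht.1.le
    (hx.absolutelyContinuousOnInterval_gap i j hs (hs.trans ht.1.le))
    (hx.ae_hasDerivAt_gap hs fun τ hτ => (hsub (hsub' τ hτ)).1) fun τ hτ => ?_
  have : 2 < v τ := (hsub (hsub' τ hτ)).2
  linarith [le_of_abs_le (abs_pull_le (gap i j (x τ)))]

theorem exists_forall_gap_eq_one (hx : IsCaratheodorySolution t₀ x) {v : ℝ → ℝ} (hs : t₀ < s)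
    (hij : gap i j (x s) = 1) (hv : ContinuousAt v s) (hnonneg : ∀ t, t₀ ≤ t → 0 ≤ v t)
    (htwo : v s < 2)
    (hfield : ∀ᶠ t in 𝓝 s, field (x t) j - field (x t) i = v t - 2 * pull (gap i j (x t))) :
    ∃ a ∈ Ico t₀ s, ∀ t ∈ Ioo a s, gap i j (x t) = 1 := by
  have hcont : ContinuousAt (fun t => gap i j (x t)) s :=
    (gap i j).continuous_of_finiteDimensional.continuousAt.comp (hx.continuousAt hs)
  obtain ⟨a, ha, hsub⟩ := exists_Ioc_subset_of_mem_nhds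
    ((hfield.and (hv.eventually_lt (hcont.const_mul 2) (by rwa [hij, mul_one]))).and
      (hcont.eventually (lt_mem_nhds (hij ▸ one_pos)))) ⟨t₀, hs⟩
  refine ⟨max t₀ a, ⟨le_max_left _ _, max_lt hs ha⟩, fun t ht => ?_⟩
  obtain ⟨ht₀, hat⟩ := max_lt_iff.1 ht.1
  have hsub' : ∀ τ ∈ Ioo t s, τ ∈ Ioc a s := fun τ hτ => ⟨hat.trans hτ.1, hτ.2.le⟩
  exact eq_one_of_ae_hasDerivAt_sub_pull (g := fun τ => gap i j (x τ)) (v := v) ht.2.le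
    (hx.absolutelyContinuousOnInterval_gap i j ht₀.le hs.le)
    (hx.ae_hasDerivAt_gap ht₀.le fun τ hτ => (hsub (hsub' τ hτ)).1.1)
    (fun τ hτ => (hsub (hsub' τ hτ)).2) (fun τ hτ => hnonneg τ (ht₀.trans hτ.1).le)
    (fun τ hτ => (hsub (hsub' τ hτ)).1.2.le) hij

theorem one_le_gap (hx : IsCaratheodorySolution t₀ x) (hg : IsGeneric t₀ x)
    (hr : t₀ ≤ r) (hrt : r ≤ t) (hcons : ∀ m, x r m ≤ x r i ∨ x r j ≤ x r m)
    (h : 1 ≤ gap i j (x r)) : 1 ≤ gap i j (x t) := by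
  by_contra! hlt
  obtain ⟨s, hs, hone, hafter⟩ := exists_last_eq (g := fun τ => gap i j (x τ)) hrt
    (uIcc_of_le hrt ▸
      (hx.absolutelyContinuousOnInterval_gap i j hr (hr.trans hrt)).continuousOn) h hlt.le
  have hne : i ≠ j := by
    rintro rfl
    simp at hone
  have hs₀ : t₀ < s := (hr.trans hs.1).lt_of_ne fun e =>
    hg.gap_ne_one 0 le_rfl i j hne (by simpa [e] using hone)
  have hst : s < t := hs.2.lt_of_ne fun e => hlt.ne (e ▸ hone)
  set I := neighbors (x s) i
  set J := neighbors (x s) j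
  have hcons' : ∀ m, x s m ≤ x s i ∨ x s j ≤ x s m := fun m =>
    (hcons m).imp (hx.le_iff_le hg.injective hr hs₀.le).1 (hx.le_iff_le hg.injective hr hs₀.le).1
  have hbelow : ∀ m ∈ I, x s m ≤ x s i := fun m => le_of_mem_neighbors_left hone.ge (hcons' m)
  have habove : ∀ m ∈ J, x s j ≤ x s m := fun m => le_of_mem_neighbors_right hone.ge (hcons' m)
  have hcont : ContinuousAt (fun τ => spread i j I J (x τ)) s :=
    (spread i j I J).continuous_of_finiteDimensional.continuousAt.comp (hx.continuousAt hs₀)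
  have hfield := eventually_field_sub_field_eq (hx.continuousAt hs₀) hone fun a b hab =>
    hg.abs_sub_ne_one hs₀.le hone hab
  rcases (hg.spread_ne_two hs₀.le hone hbelow habove).lt_or_gt with htwo | htwo
  · obtain ⟨a, ha, heq⟩ := hx.exists_forall_gap_eq_one hs₀ hone hcont (fun τ hτ => spread_nonneg
      (fun m hm => (hx.le_iff_le hg.injective hs₀.le hτ).1 (hbelow m hm))
      (fun m hm => (hx.le_iff_le hg.injective hs₀.le hτ).1 (habove m hm))) htwo hfield
    obtain ⟨q, haq, hqs⟩ := exists_rat_btwn (sub_lt_sub_right ha.2 t₀)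
    exact hg.gap_ne_one q (by exact_mod_cast (sub_nonneg.2 ha.1).trans haq.le) i j hne
      (heq _ ⟨sub_lt_iff_lt_add'.1 haq, lt_sub_iff_add_lt'.1 hqs⟩)
  · obtain ⟨τ, hle, hτ⟩ := ((hx.eventually_one_le_gap hs₀.le hone hcont htwo hfield).and
      (Ioc_mem_nhdsGT hst)).exists
    exact (hafter τ hτ).not_ge hle

theorem reachable_of_abs_lt (hx : IsCaratheodorySolution t₀ x) (hg : IsGeneric t₀ x)
    (hs : t₀ ≤ s) (hst : s ≤ t) (h : |x t i - x t j| < 1) :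
    (interactionGraph (x s)).Reachable i j := by
  wlog hij : x s i ≤ x s j generalizing i j
  · exact (this (by rwa [abs_sub_comm]) (le_of_not_ge hij)).symm
  by_contra hnot
  obtain ⟨k, l, hik, hlj, hkl, hcons⟩ := exists_consecutive_gap hij hnot
  have hgap : 1 ≤ x t l - x t k := hx.one_le_gap hg hs hst hcons hkl
  have hik' := (hx.le_iff_le hg.injective hs (hs.trans hst)).1 hik
  have hlj' := (hx.le_iff_le hg.injective hs (hs.trans hst)).1 hlj
  linarith [neg_lt_of_abs_lt h]

theorem antitoneOn_localVariance (hx : IsCaratheodorySolution t₀ x) (hg : IsGeneric t₀ x) :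
    AntitoneOn (fun t => localVariance (x t)) (Ici t₀) := by
  intro s hs t _ hst
  have hsplit : ∀ τ ∈ Icc s t, ∀ i j, |x τ i - x τ j| < 1 →
      clusterMean (x s) i = clusterMean (x s) j := fun τ hτ i j h =>
    clusterMean_eq_of_reachable (hx.reachable_of_abs_lt hg hs hτ.1 h)
  calc localVariance (x t)
    _ ≤ 1 / n * ∑ i, (x t i - clusterMean (x s) i) ^ 2 :=
        localVariance_le (hsplit t (right_mem_Icc.2 hst))
    _ ≤ localVariance (x s) :=
        mul_le_mul_of_nonneg_left (hx.sum_sq_sub_const_le hs hst hsplit) (by positivity)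

end IsCaratheodorySolution

end HK

theorem mainTheorem2 (n : ℕ) (t₀ : ℝ) :
    (∀ᵐ x₀ : Fin n → ℝ ∂(MeasureTheory.volume : MeasureTheory.Measure (Fin n → ℝ)),
      ∀ x : ℝ → Fin n → ℝ, HK.IsCaratheodorySolution t₀ x → x t₀ = x₀ →
        AntitoneOn (fun t => HK.localVariance (x t)) (Set.Ici t₀)) ∧
    (∀ x : ℝ → Fin n → ℝ, HK.IsCaratheodorySolution t₀ x →
      Filter.Tendsto (fun t => HK.localVariance (x t)) Filter.atTop (nhds 0)) := by
  refine ⟨?_, fun x hx => hx.tendsto_localVariance⟩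
  filter_upwards [HK.ae_isGeneric t₀] with x₀ hgeneric x hx hx₀
  exact hx.antitoneOn_localVariance (hgeneric x hx hx₀)
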